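/- For real $x>-\tfrac12$ write $\binom{2x}{x}=\Gamma(2x+1)/\Gamma(x+1)^2$, and put $f(x)=\binom{2x}{x}4^{-x}=\dfrac{\Gamma(2x+1)}{\Gamma(x+1)^2\,4^x}$. Let $c_n$ be the Cauchy numbers (of the first kind), defined by $\dfrac{x}{\ln(1+x)}=\sum_{n=0}^\infty \dfrac{c_n}{n!}x^n$, and let $s(n,k)$ be the signed Stirling numbers of the first kind, defined by $z(z-1)\cdots(z-n+1)=\sum_{k=0}^n s(n,k)z^k$. 1. $f$ is integrable on $[0,1]$, and the following series converges absolutely with $$\sum_{n=0}^{\infty}\frac{(-1)^n c_n}{n!\,4^n}\binom{2n}{n}=\int_0^1\binom{2x}{x}\frac{1}{4^x}\,dx\approx 0.6703837612,$$ where the decimal value is correct to ten places, i.e. within $5\cdot 10^{-11}$. 2. $f$ is real-analytic at $0$, and for every integer $m\ge 1$ the following series converges absolutely with $$\frac{f^{(m)}(0)}{m!}=\sum_{n=1}^{\infty}\frac{(-1)^n s(n,m)}{n!\,4^n}\binom{2n}{n}.$$ -/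

import Mathlib

noncomputable section

/-- The formal power series `log (1 + X) / X`, i.e. the expansion of `log (1 + X)` with every
exponent lowered by one. -/
def logOverX : PowerSeries ℝ :=
  PowerSeries.mk fun k => PowerSeries.coeff (k + 1) (PowerSeries.log ℝ)

/-- The Cauchy numbers (of the first kind) `c n`, with exponential generating function
`X / log (1 + X) = ∑ n, c n / n! * X ^ n`. -/
def cauchyNumber (n : ℕ) : ℝ :=
  (n.factorial : ℝ) * PowerSeries.coeff n (logOverX⁻¹)

/-- The (signed) Stirling numbers of the first kind `s n k`, given by
`z (z - 1) ⋯ (z - n + 1) = ∑ k, s n k * z ^ k`. -/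
def signedStirlingFirst (n k : ℕ) : ℤ :=
  (descPochhammer ℤ n).coeff k

/-- The central binomial coefficient `binom (2 x) x` at a real argument `x`, through the Gamma
function. -/
def realCentralBinom (x : ℝ) : ℝ :=
  Real.Gamma (2 * x + 1) / Real.Gamma (x + 1) ^ 2

theorem X_mul_logOverX : PowerSeries.X * logOverX = PowerSeries.log ℝ := by
  ext n
  cases n with
  | zero => simp
  | succ k => rw [PowerSeries.coeff_succ_X_mul, logOverX, PowerSeries.coeff_mk]

/-- The defining identity `X = log (1 + X) * ∑ n, c n / n! * X ^ n` of the Cauchy numbers. -/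
theorem log_mul_cauchyNumber_egf :
    PowerSeries.log ℝ * (PowerSeries.mk fun n => cauchyNumber n / (n.factorial : ℝ)) =
      PowerSeries.X := by
  have h : (PowerSeries.mk fun n => cauchyNumber n / (n.factorial : ℝ)) = logOverX⁻¹ := by
    ext n
    rw [PowerSeries.coeff_mk, cauchyNumber, mul_div_cancel_left₀]
    exact_mod_cast n.factorial_ne_zero
  have h0 : PowerSeries.constantCoeff logOverX ≠ 0 := by
    rw [← PowerSeries.coeff_zero_eq_constantCoeff_apply, logOverX, PowerSeries.coeff_mk]
    simp
  rw [h, ← X_mul_logOverX, mul_assoc, PowerSeries.mul_inv_cancel _ h0, mul_one]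

theorem realCentralBinom_natCast (n : ℕ) : realCentralBinom n = (n.centralBinom : ℝ) := by
  have h2 : Real.Gamma (2 * (n : ℝ) + 1) = ((2 * n).factorial : ℝ) := by
    have := Real.Gamma_nat_eq_factorial (2 * n)
    push_cast at this
    exact this
  rw [realCentralBinom, h2, Real.Gamma_nat_eq_factorial, Nat.centralBinom,
    Nat.cast_choose ℝ (by omega : n ≤ 2 * n), show 2 * n - n = n by omega, sq]

end

open MeasureTheory ProbabilityTheory Finset

/-! The function f is a moment function: f(x) = ∫ t^x dμ(t) for x > -1/2, with μ the arcsine law on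
(0,1); this is Legendre duplication (`integral_rpow_arcsineMeasure`). Expanding t^x = (1 + (t -
1))^x by the binomial series and integrating termwise gives the Newton series f(x) = ∑ (-1)^n C(x,n)
binom(2n,n)/4^n (`hasSum_newton`).

Part 1 integrates this series over x in [0,1], because ∫ C(x,n) dx = c_n/n!
(`cauchyNumber_eq_integral`). Part 2 expands n! C(x,n) = ∑ s(n,m) x^m and exchanges the sums for |x|
≤ 1/4 (`hasSum_taylor`); uniqueness of power series then identifies the Taylor coefficients. Real
`HasSum` is unconditional, which is absolute convergence.

The decimal value comes from a rational 13-point Gauss rule. Its error is controlled by Taylor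
polynomials of f at 1/2, whose coefficients are again integrals against μ (`exists_taylor_coeff`).
The node values come from the functional equation of f and a truncated Newton series at x + 25
(`abs_sub_newtonApprox_le`). -/

/-! ### Binomial coefficients with real upper argument and the binomial series. -/

theorem factorial_mul_choose_real (x : ℝ) (n : ℕ) :
    (n.factorial : ℝ) * Ring.choose x n = Polynomial.aeval x (descPochhammer ℤ n) := by
  rw [Polynomial.aeval_eq_smeval, Ring.descPochhammer_eq_factorial_smul_choose, nsmul_eq_mul]

theorem choose_real_succ (x : ℝ) (n : ℕ) :
    Ring.choose x (n + 1) = Ring.choose x n * ((x - n) / (n + 1)) := by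
  have h1 := factorial_mul_choose_real x (n + 1)
  have h0 := factorial_mul_choose_real x n
  rw [descPochhammer_succ_right, map_mul, ← h0, Nat.factorial_succ] at h1
  simp only [map_sub, Polynomial.aeval_X, map_natCast] at h1
  have hf : (n.factorial : ℝ) ≠ 0 := by exact_mod_cast n.factorial_ne_zero
  have hn : (n : ℝ) + 1 ≠ 0 := by positivity
  push_cast at h1
  field_simp
  apply mul_left_cancel₀ hf
  linear_combination h1

theorem continuous_choose_real (n : ℕ) : Continuous fun x : ℝ => Ring.choose x n := by
  induction n with
  | zero => simpa using continuous_const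
  | succ n ih =>
    simp only [choose_real_succ]
    fun_prop

theorem hasSum_choose_mul_pow {x t : ℝ} (h0 : 0 < t) (h2 : t < 2) :
    HasSum (fun n => Ring.choose x n * (t - 1) ^ n) (t ^ x) := by
  have h := (Real.one_add_rpow_hasFPowerSeriesOnBall_zero (a := x)).hasSum (y := t - 1) (by
    simp only [Metric.mem_eball, edist_zero_right]
    rw [Real.enorm_eq_ofReal_abs, ENNReal.ofReal_lt_one, abs_lt]
    constructor <;> linarith)
  simpa [-FormalMultilinearSeries.apply_eq_prod_smul_coeff, binomialSeries_apply, List.ofFn_const]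
    using h

/-- The partial product `∏_{k ≤ n} (1 - x / k)`. -/
noncomputable def oneSubProd (x : ℝ) (n : ℕ) : ℝ := ∏ k ∈ range n, (1 - x / (k + 1))

theorem oneSubProd_nonneg {x : ℝ} (h1 : x ≤ 1) (n : ℕ) : 0 ≤ oneSubProd x n := by
  refine prod_nonneg fun k _ => ?_
  rw [sub_nonneg, div_le_one (by positivity)]
  linarith [(Nat.cast_nonneg k : (0 : ℝ) ≤ k)]

theorem oneSubProd_le_one {x : ℝ} (h0 : 0 ≤ x) (h1 : x ≤ 1) (n : ℕ) : oneSubProd x n ≤ 1 := by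
  refine prod_le_one (fun k _ => ?_) fun k _ => ?_
  · rw [sub_nonneg, div_le_one (by positivity)]
    linarith [(Nat.cast_nonneg k : (0 : ℝ) ≤ k)]
  · rw [sub_le_self_iff]
    positivity

theorem oneSubProd_sub_succ (x : ℝ) (n : ℕ) :
    oneSubProd x n - oneSubProd x (n + 1) = oneSubProd x n * (x / (n + 1)) := by
  rw [oneSubProd, oneSubProd, prod_range_succ]
  ring

/-- On [0,1] the partial products decrease in n, so the absolute values of the coefficients
telescope. -/
theorem choose_real_succ_eq (x : ℝ) (n : ℕ) :
    Ring.choose x (n + 1) = (-1) ^ n * (oneSubProd x n - oneSubProd x (n + 1)) := by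
  induction n with
  | zero => simp [oneSubProd]
  | succ n ih =>
    have hn : (n : ℝ) + 1 ≠ 0 := by positivity
    have hn' : (n : ℝ) + 1 + 1 ≠ 0 := by positivity
    rw [choose_real_succ, ih, oneSubProd_sub_succ, oneSubProd_sub_succ,
      show oneSubProd x (n + 1) = oneSubProd x n * (1 - x / (n + 1)) from prod_range_succ _ _]
    push_cast
    field_simp
    ring

theorem abs_choose_real_succ {x : ℝ} (h0 : 0 ≤ x) (h1 : x ≤ 1) (n : ℕ) :
    |Ring.choose x (n + 1)| = oneSubProd x n - oneSubProd x (n + 1) := by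
  rw [choose_real_succ_eq, abs_mul, abs_pow, abs_neg, abs_one, one_pow, one_mul, abs_of_nonneg]
  rw [oneSubProd_sub_succ]
  exact mul_nonneg (oneSubProd_nonneg h1 n) (by positivity)

theorem abs_choose_real_succ_le {x : ℝ} (h0 : 0 ≤ x) (h1 : x ≤ 1) (n : ℕ) :
    |Ring.choose x (n + 1)| ≤ 1 / (n + 1) := by
  rw [abs_choose_real_succ h0 h1, oneSubProd_sub_succ]
  calc oneSubProd x n * (x / (n + 1)) ≤ 1 * (1 / (n + 1)) := by
        gcongr
        exact oneSubProd_le_one h0 h1 n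
    _ = _ := one_mul _

/-- By telescoping, the absolute coefficients beyond index m sum to at most 1, and every tail power
of 1 - t is at most (1 - t)^(m+1). -/
theorem abs_rpow_sub_sum_choose_le {x t : ℝ} (h0 : 0 ≤ x) (h1 : x ≤ 1) (ht0 : 0 < t) (ht1 : t < 1)
    (m : ℕ) :
    |t ^ x - ∑ n ∈ range (m + 1), Ring.choose x n * (t - 1) ^ n| ≤ (1 - t) ^ (m + 1) := by
  have hs := hasSum_choose_mul_pow (x := x) ht0 (by linarith)
  have hs' := (hasSum_nat_add_iff' (m + 1)).2 hs
  have hnn (n : ℕ) : 0 ≤ |Ring.choose x (n + (m + 1))| := abs_nonneg _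
  have hb (k : ℕ) : ∑ n ∈ range k, |Ring.choose x (n + (m + 1))| ≤ 1 := by
    have : ∀ k, ∑ n ∈ range k, |Ring.choose x (n + (m + 1))|
        = oneSubProd x m - oneSubProd x (k + m) := by
      intro k
      induction k with
      | zero => simp
      | succ k ih =>
        rw [sum_range_succ, ih, ← add_assoc, abs_choose_real_succ h0 h1,
          show k + 1 + m = k + m + 1 by ring]
        ring
    rw [this]
    linarith [oneSubProd_le_one h0 h1 m, oneSubProd_nonneg h1 (k + m)]
  have hsum : Summable fun n => |Ring.choose x (n + (m + 1))| :=
    summable_of_sum_range_le hnn hb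
  have hle : ∑' n, |Ring.choose x (n + (m + 1))| ≤ 1 := Real.tsum_le_of_sum_range_le hnn hb
  have hpow : (0 : ℝ) ≤ (1 - t) ^ (m + 1) := pow_nonneg (by linarith) _
  rw [← hs'.tsum_eq]
  calc |∑' n, Ring.choose x (n + (m + 1)) * (t - 1) ^ (n + (m + 1))|
      ≤ ∑' n, |Ring.choose x (n + (m + 1))| * (1 - t) ^ (m + 1) := by
        refine tsum_of_norm_bounded (E := ℝ) (hsum.mul_right _).hasSum fun n => ?_
        rw [Real.norm_eq_abs, abs_mul, abs_pow, abs_sub_comm t 1, abs_of_pos (by linarith : 0 < 1 - t)]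
        refine mul_le_mul_of_nonneg_left ?_ (hnn n)
        exact pow_le_pow_of_le_one (by linarith) (by linarith) (by omega)
    _ = (∑' n, |Ring.choose x (n + (m + 1))|) * (1 - t) ^ (m + 1) := tsum_mul_right
    _ ≤ 1 * (1 - t) ^ (m + 1) := by gcongr
    _ = _ := one_mul _

/-! ### The arcsine law and its moments. -/

theorem integral_betaPDFReal {p q : ℝ} (hp : 0 < p) (hq : 0 < q) :
    Integrable (betaPDFReal p q) ∧ ∫ t, betaPDFReal p q t = 1 := by
  have hnn (t : ℝ) : 0 ≤ betaPDFReal p q t := by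
    by_cases h : 0 < t ∧ t < 1
    · exact (betaPDFReal_pos h.1 h.2 hp hq).le
    · rw [betaPDFReal, if_neg h]
  have h1 := lintegral_betaPDF_eq_one hp hq
  have hm : AEStronglyMeasurable (betaPDFReal p q) :=
    (stronglyMeasurable_betaPDFReal p q).aestronglyMeasurable
  constructor
  · refine ⟨hm, ?_⟩
    rw [hasFiniteIntegral_iff_ofReal (Filter.Eventually.of_forall hnn)]
    exact h1.trans_lt ENNReal.one_lt_top
  · rw [integral_eq_lintegral_of_nonneg_ae (Filter.Eventually.of_forall hnn) hm]
    change (∫⁻ t, betaPDF p q t).toReal = 1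
    rw [h1, ENNReal.toReal_one]

theorem beta_half_half : beta (1 / 2) (1 / 2) = Real.pi := by
  rw [beta, Real.Gamma_one_half_eq, add_halves, Real.Gamma_one, div_one,
    Real.mul_self_sqrt Real.pi_pos.le]

/-- The arcsine distribution on `(0, 1)`. -/
noncomputable def arcsineMeasure : Measure ℝ := betaMeasure (1 / 2) (1 / 2)

instance : IsProbabilityMeasure arcsineMeasure :=
  isProbabilityMeasureBeta (by norm_num) (by norm_num)

theorem measurable_betaPDF_half : Measurable (betaPDF (1 / 2) (1 / 2)) :=
  (measurable_betaPDFReal _ _).ennreal_ofReal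

theorem ae_arcsineMeasure : ∀ᵐ t ∂arcsineMeasure, 0 < t ∧ t < 1 := by
  rw [arcsineMeasure, betaMeasure, ae_withDensity_iff measurable_betaPDF_half]
  refine Filter.Eventually.of_forall fun t ht => ?_
  by_contra h
  apply ht
  rw [betaPDF_eq, if_neg h, ENNReal.ofReal_zero]

theorem betaPDF_mul_rpow {p q : ℝ} (hp : -(1 / 2) < p) (hq : -(1 / 2) < q) (t : ℝ) :
    (betaPDF (1 / 2) (1 / 2) t).toReal • (t ^ p * (1 - t) ^ q) =
      beta (p + 1 / 2) (q + 1 / 2) / Real.pi * betaPDFReal (p + 1 / 2) (q + 1 / 2) t := by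
  have hb := (beta_pos (by linarith : 0 < p + 1 / 2) (by linarith : 0 < q + 1 / 2)).ne'
  rw [betaPDF_eq, betaPDFReal]
  by_cases h : 0 < t ∧ t < 1
  · have h1 : 0 < 1 - t := by linarith [h.2]
    rw [if_pos h, if_pos h, ENNReal.toReal_ofReal, beta_half_half, smul_eq_mul,
      show p + 1 / 2 - 1 = p + (1 / 2 - 1) by ring, show q + 1 / 2 - 1 = q + (1 / 2 - 1) by ring,
      Real.rpow_add h.1, Real.rpow_add h1]
    · generalize beta (p + 1 / 2) (q + 1 / 2) = b at hb ⊢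
      field_simp
    · rw [beta_half_half]
      have := Real.pi_pos
      have := Real.rpow_pos_of_pos h.1 (1 / 2 - 1)
      have := Real.rpow_pos_of_pos h1 (1 / 2 - 1)
      positivity
  · rw [if_neg h, if_neg h]
    simp

theorem integrable_rpow_mul_rpow {p q : ℝ} (hp : -(1 / 2) < p) (hq : -(1 / 2) < q) :
    Integrable (fun t => t ^ p * (1 - t) ^ q) arcsineMeasure := by
  rw [arcsineMeasure, betaMeasure, integrable_withDensity_iff_integrable_smul'
    measurable_betaPDF_half (by
      refine Filter.Eventually.of_forall fun t => ENNReal.ofReal_lt_top)]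
  simp_rw [betaPDF_mul_rpow hp hq]
  exact (integral_betaPDFReal (by linarith) (by linarith)).1.const_mul _

theorem integral_rpow_mul_rpow {p q : ℝ} (hp : -(1 / 2) < p) (hq : -(1 / 2) < q) :
    ∫ t, t ^ p * (1 - t) ^ q ∂arcsineMeasure = beta (p + 1 / 2) (q + 1 / 2) / Real.pi := by
  rw [arcsineMeasure, betaMeasure, integral_withDensity_eq_integral_toReal_smul
    measurable_betaPDF_half (by
      refine Filter.Eventually.of_forall fun t => ENNReal.ofReal_lt_top)]
  simp_rw [betaPDF_mul_rpow hp hq]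
  rw [integral_const_mul, (integral_betaPDFReal (by linarith) (by linarith)).2, mul_one]

/-- Legendre's duplication formula at x + 1/2. -/
theorem realCentralBinom_div_eq_Gamma {x : ℝ} (hx : -(1 / 2) < x) :
    realCentralBinom x / 4 ^ x = beta (x + 1 / 2) (1 / 2) / Real.pi := by
  have h := Real.Gamma_mul_Gamma_add_half (x + 1 / 2)
  rw [show x + 1 / 2 + 1 / 2 = x + 1 by ring, show 2 * (x + 1 / 2) = 2 * x + 1 by ring,
    show 1 - (2 * x + 1) = -(2 * x) by ring, Real.rpow_neg (by norm_num), Real.rpow_mul (by norm_num),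
    show (2 : ℝ) ^ (2 : ℝ) = 4 by norm_num] at h
  have h1 : Real.Gamma (x + 1) ≠ 0 := (Real.Gamma_pos_of_pos (by linarith)).ne'
  have h4 : (4 : ℝ) ^ x ≠ 0 := (Real.rpow_pos_of_pos (by norm_num) x).ne'
  have hp := Real.pi_pos.ne'
  have hs := Real.mul_self_sqrt Real.pi_pos.le
  have hs0 : √Real.pi ≠ 0 := (Real.sqrt_pos.2 Real.pi_pos).ne'
  rw [beta, Real.Gamma_one_half_eq, realCentralBinom, show x + 1 / 2 + 1 / 2 = x + 1 by ring]
  generalize Real.Gamma (2 * x + 1) = G at *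
  generalize Real.Gamma (x + 1 / 2) = H at *
  field_simp at h ⊢
  rw [← mul_right_inj' hs0]
  linear_combination (-√Real.pi ^ 2) * h - G * √Real.pi * hs

theorem integrable_rpow_arcsineMeasure {x : ℝ} (hx : -(1 / 2) < x) :
    Integrable (fun t => t ^ x) arcsineMeasure := by
  simpa using integrable_rpow_mul_rpow hx (q := 0) (by norm_num)

theorem integral_rpow_arcsineMeasure {x : ℝ} (hx : -(1 / 2) < x) :
    ∫ t, t ^ x ∂arcsineMeasure = realCentralBinom x / 4 ^ x := by
  rw [realCentralBinom_div_eq_Gamma hx]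
  simpa using integral_rpow_mul_rpow hx (q := 0) (by norm_num)

/-- The normalized central binomial coefficient `binom (2 n) n / 4 ^ n`. -/
noncomputable def centralRatio (n : ℕ) : ℝ := (n.centralBinom : ℝ) / 4 ^ n

theorem centralRatio_pos (n : ℕ) : 0 < centralRatio n :=
  div_pos (by exact_mod_cast n.centralBinom_pos) (by positivity)

theorem centralRatio_succ (n : ℕ) :
    centralRatio (n + 1) = centralRatio n * ((2 * n + 1) / (2 * n + 2)) := by
  have h : ((n : ℝ) + 1) * (n + 1).centralBinom = 2 * (2 * n + 1) * n.centralBinom := by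
    exact_mod_cast n.succ_mul_centralBinom_succ
  rw [centralRatio, centralRatio, pow_succ]
  have h4 : (4 : ℝ) ^ n ≠ 0 := by positivity
  have h1 : (2 * (n : ℝ) + 2) ≠ 0 := by positivity
  field_simp
  linear_combination 2 * h

/-- Each term is twice the decrement of `centralRatio` from n to n + 1, so the partial sums
telescope. -/
theorem summable_centralRatio_div : Summable fun n : ℕ => centralRatio n / (n + 1) := by
  refine summable_of_sum_range_le (c := 2)
    (fun n => div_nonneg (centralRatio_pos n).le (by positivity)) fun k => ?_
  have h : ∑ n ∈ range k, centralRatio n / (n + 1) = 2 * (1 - centralRatio k) := by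
    induction k with
    | zero => simp [centralRatio]
    | succ k ih =>
      rw [sum_range_succ, ih, centralRatio_succ]
      have : (k : ℝ) + 1 ≠ 0 := by positivity
      have : 2 * (k : ℝ) + 2 ≠ 0 := by positivity
      field_simp
      ring
  rw [h]
  linarith [centralRatio_pos k]

theorem realCentralBinom_natCast_div (n : ℕ) :
    realCentralBinom n / 4 ^ (n : ℝ) = centralRatio n := by
  rw [realCentralBinom_natCast, Real.rpow_natCast, centralRatio]

theorem Gamma_nat_add_half_eq_centralRatio (n : ℕ) :
    Real.Gamma (n + 1 / 2) = √Real.pi * n.factorial * centralRatio n := by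
  have hn : -(1 / 2 : ℝ) < n := by linarith [(Nat.cast_nonneg n : (0 : ℝ) ≤ n)]
  have h := realCentralBinom_div_eq_Gamma hn
  rw [realCentralBinom_natCast_div, beta, Real.Gamma_one_half_eq,
    show (n : ℝ) + 1 / 2 + 1 / 2 = n + 1 by ring, Real.Gamma_nat_eq_factorial] at h
  have hs0 : √Real.pi ≠ 0 := (Real.sqrt_pos.2 Real.pi_pos).ne'
  have hf : (n.factorial : ℝ) ≠ 0 := by exact_mod_cast n.factorial_ne_zero
  have hs := Real.mul_self_sqrt Real.pi_pos.le
  have hp := Real.pi_pos.ne'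
  rw [h]
  field_simp
  linear_combination (-1 : ℝ) * hs

theorem integrable_pow_mul_pow (N n : ℕ) :
    Integrable (fun t => t ^ N * (1 - t) ^ n) arcsineMeasure := by
  simpa using integrable_rpow_mul_rpow (p := N) (q := n)
    (by linarith [(Nat.cast_nonneg N : (0 : ℝ) ≤ N)])
    (by linarith [(Nat.cast_nonneg n : (0 : ℝ) ≤ n)])

theorem integral_pow_mul_pow (N n : ℕ) :
    ∫ t, t ^ N * (1 - t) ^ n ∂arcsineMeasure =
      centralRatio N * centralRatio n / (N + n).choose n := by
  have h := integral_rpow_mul_rpow (p := N) (q := n)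
    (by linarith [(Nat.cast_nonneg N : (0 : ℝ) ≤ N)])
    (by linarith [(Nat.cast_nonneg n : (0 : ℝ) ≤ n)])
  simp only [Real.rpow_natCast] at h
  rw [h, beta, Gamma_nat_add_half_eq_centralRatio, Gamma_nat_add_half_eq_centralRatio,
    show (N : ℝ) + 1 / 2 + (n + 1 / 2) = (N + n : ℕ) + 1 by push_cast; ring,
    Real.Gamma_nat_eq_factorial, ← Nat.add_choose_mul_factorial_mul_factorial N n]
  have hs := Real.mul_self_sqrt Real.pi_pos.le
  have hp := Real.pi_pos.ne'
  have hN : (N.factorial : ℝ) ≠ 0 := by exact_mod_cast N.factorial_ne_zero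
  have hn : (n.factorial : ℝ) ≠ 0 := by exact_mod_cast n.factorial_ne_zero
  have hc : ((N + n).choose n : ℝ) ≠ 0 := by
    exact_mod_cast (Nat.choose_pos (Nat.le_add_left n N)).ne'
  push_cast
  field_simp
  rw [sq, hs]
  ring

theorem integrable_one_sub_pow (n : ℕ) :
    Integrable (fun t => (1 - t) ^ n) arcsineMeasure := by
  simpa using integrable_pow_mul_pow 0 n

theorem integral_one_sub_pow (n : ℕ) :
    ∫ t, (1 - t) ^ n ∂arcsineMeasure = centralRatio n := by
  simpa [centralRatio] using integral_pow_mul_pow 0 n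

/-! ### The Newton series and its integral over [0,1]. -/

/-- The Newton series of `binom (2 x) x / 4 ^ x` at the nonnegative integers. -/
theorem hasSum_newton {x : ℝ} (hx : -(1 / 2) < x)
    (hs : Summable fun n => |Ring.choose x n| * centralRatio n) :
    HasSum (fun n => (-1) ^ n * Ring.choose x n * centralRatio n)
      (realCentralBinom x / 4 ^ x) := by
  have hpow (n : ℕ) (t : ℝ) : (t - 1) ^ n = (-1) ^ n * (1 - t) ^ n := by
    rw [← mul_pow]
    ring
  have hI (n : ℕ) : Integrable (fun t => Ring.choose x n * (t - 1) ^ n) arcsineMeasure := by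
    simp_rw [hpow]
    exact ((integrable_one_sub_pow n).const_mul _).const_mul _
  have hN (n : ℕ) : ∫ t, ‖Ring.choose x n * (t - 1) ^ n‖ ∂arcsineMeasure =
      |Ring.choose x n| * centralRatio n := by
    rw [← integral_one_sub_pow, ← integral_const_mul]
    refine integral_congr_ae ?_
    filter_upwards [ae_arcsineMeasure] with t ht
    rw [Real.norm_eq_abs, abs_mul, abs_pow, abs_sub_comm t, abs_of_pos (by linarith [ht.2] : 0 < 1 - t)]
  -- Since 1 - t > 0 almost everywhere, the L¹ norms of the terms are exactly the summands of `hs`,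
  -- so sum and integral commute.
  have h := hasSum_integral_of_summable_integral_norm hI (by simpa only [hN] using hs)
  have hf : ∫ t, (∑' n, Ring.choose x n * (t - 1) ^ n) ∂arcsineMeasure =
      realCentralBinom x / 4 ^ x := by
    rw [← integral_rpow_arcsineMeasure hx]
    refine integral_congr_ae ?_
    filter_upwards [ae_arcsineMeasure] with t ht
    exact (hasSum_choose_mul_pow ht.1 (by linarith [ht.2])).tsum_eq
  rw [hf] at h
  convert! h using 2 with n
  simp_rw [hpow]
  rw [integral_const_mul, integral_const_mul, integral_one_sub_pow]
  ring

theorem abs_choose_mul_centralRatio_le {x : ℝ} (h0 : 0 ≤ x) (h1 : x ≤ 1) (n : ℕ) :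
    |Ring.choose x (n + 1)| * centralRatio (n + 1) ≤ centralRatio n / (n + 1) := by
  have h := abs_choose_real_succ_le h0 h1 n
  have ha : centralRatio (n + 1) ≤ centralRatio n := by
    rw [centralRatio_succ]
    refine mul_le_of_le_one_right (centralRatio_pos n).le ?_
    rw [div_le_one (by positivity)]
    linarith
  calc _ ≤ 1 / ((n : ℝ) + 1) * centralRatio n :=
        mul_le_mul h ha (centralRatio_pos _).le (by positivity)
    _ = _ := by ring

theorem hasSum_newton_of_mem_Icc {x : ℝ} (h0 : 0 ≤ x) (h1 : x ≤ 1) :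
    HasSum (fun n => (-1) ^ n * Ring.choose x n * centralRatio n)
      (realCentralBinom x / 4 ^ x) := by
  refine hasSum_newton (by linarith) ((summable_nat_add_iff 1).1 ?_)
  exact summable_centralRatio_div.of_nonneg_of_le
    (fun n => mul_nonneg (abs_nonneg _) (centralRatio_pos _).le)
    (abs_choose_mul_centralRatio_le h0 h1)

theorem hasSum_integral_newton :
    HasSum (fun n => (-1) ^ n * (∫ x in (0 : ℝ)..1, Ring.choose x n) * centralRatio n)
      (∫ x in (0 : ℝ)..1, realCentralBinom x / 4 ^ x) := by
  -- A dominating series independent of x; the estimate covers indices n + 1 only, so index 0 gets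
  -- the value 1 by hand.
  have hb : Summable fun n : ℕ =>
      if n = 0 then (1 : ℝ) else centralRatio (n - 1) / ((n - 1 : ℕ) + 1) := by
    refine (summable_nat_add_iff 1).1 ?_
    simpa using summable_centralRatio_div
  have h := intervalIntegral.hasSum_integral_of_dominated_convergence (μ := volume)
    (a := (0 : ℝ)) (b := 1)
    (F := fun (n : ℕ) x => (-1) ^ n * Ring.choose x n * centralRatio n)
    (f := fun x => realCentralBinom x / 4 ^ x)
    (fun n _ => if n = 0 then (1 : ℝ) else centralRatio (n - 1) / ((n - 1 : ℕ) + 1))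
    (fun n => by
      have := continuous_choose_real n
      exact Continuous.aestronglyMeasurable (by fun_prop))
    (fun n => Filter.Eventually.of_forall fun x hx => by
      rw [Set.uIoc_of_le zero_le_one] at hx
      rw [Real.norm_eq_abs, abs_mul, abs_mul, abs_pow, abs_neg, abs_one, one_pow, one_mul,
        abs_of_pos (centralRatio_pos n)]
      cases n with
      | zero => simp [centralRatio]
      | succ n => simpa using abs_choose_mul_centralRatio_le hx.1.le hx.2 n)
    (Filter.Eventually.of_forall fun x _ => hb)
    (by simp)
    (Filter.Eventually.of_forall fun x hx => by
      rw [Set.uIoc_of_le zero_le_one] at hx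
      exact hasSum_newton_of_mem_Icc hx.1.le hx.2)
  simpa only [intervalIntegral.integral_mul_const, intervalIntegral.integral_const_mul] using h

/-! ### Cauchy numbers as integrals of binomial coefficients. -/

theorem coeff_X_mul_derivative (f : PowerSeries ℝ) (n : ℕ) :
    PowerSeries.coeff n (PowerSeries.X * PowerSeries.derivative ℝ f) =
      n * PowerSeries.coeff n f := by
  cases n with
  | zero => simp
  | succ n =>
    rw [PowerSeries.coeff_succ_X_mul, PowerSeries.coeff_derivative]
    push_cast
    ring

theorem one_add_X_mul_derivative_choose (x : ℝ) :
    (1 + PowerSeries.X) * PowerSeries.derivative ℝ (PowerSeries.mk (Ring.choose x)) =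
      PowerSeries.C x * PowerSeries.mk (Ring.choose x) := by
  ext n
  have hn : (n : ℝ) + 1 ≠ 0 := by positivity
  rw [add_mul, one_mul, map_add, coeff_X_mul_derivative, PowerSeries.coeff_derivative,
    PowerSeries.coeff_C_mul, PowerSeries.coeff_mk, PowerSeries.coeff_mk, choose_real_succ]
  field_simp
  ring

theorem one_add_X_mul_derivative_log :
    (1 + PowerSeries.X) * PowerSeries.derivative ℝ (PowerSeries.log ℝ) = 1 := by
  rw [PowerSeries.deriv_log]
  ext n
  cases n with
  | zero => simp [add_mul]
  | succ n =>
    rw [add_mul, one_mul, map_add, PowerSeries.coeff_succ_X_mul]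
    simp [pow_succ]

/-- L = log(1+X)·(1+X)^x satisfies (1+X)L' = (1+X)^x + xL; compare coefficients. -/
theorem coeff_log_mul_choose_succ (x : ℝ) (n : ℕ) :
    (n + 1) * PowerSeries.coeff (n + 1) (PowerSeries.log ℝ * PowerSeries.mk (Ring.choose x)) =
      Ring.choose x n +
        (x - n) * PowerSeries.coeff n (PowerSeries.log ℝ * PowerSeries.mk (Ring.choose x)) := by
  set L := PowerSeries.log ℝ * PowerSeries.mk (Ring.choose x) with hL
  have h : (1 + PowerSeries.X) * PowerSeries.derivative ℝ L =
      PowerSeries.mk (Ring.choose x) + PowerSeries.C x * L := by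
    rw [hL, Derivation.leibniz, smul_eq_mul, smul_eq_mul]
    linear_combination PowerSeries.log ℝ * one_add_X_mul_derivative_choose x +
      PowerSeries.mk (Ring.choose x) * one_add_X_mul_derivative_log
  have hc := congrArg (PowerSeries.coeff n) h
  rw [add_mul, one_mul, map_add, map_add, coeff_X_mul_derivative, PowerSeries.coeff_derivative,
    PowerSeries.coeff_C_mul, PowerSeries.coeff_mk] at hc
  linear_combination hc

/-- The coefficientwise form of d/dx (1+X)^x = log(1+X)·(1+X)^x: both sides obey the same recurrence
in n. -/
theorem hasDerivAt_choose_real (n : ℕ) (x : ℝ) :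
    HasDerivAt (fun x : ℝ => Ring.choose x n)
      (PowerSeries.coeff n (PowerSeries.log ℝ * PowerSeries.mk (Ring.choose x))) x := by
  induction n with
  | zero => simpa using hasDerivAt_const x (1 : ℝ)
  | succ n ih =>
    simp only [choose_real_succ]
    have hn : (n : ℝ) + 1 ≠ 0 := by positivity
    refine (ih.mul (((hasDerivAt_id x).sub_const (n : ℝ)).div_const (n + 1))).congr_deriv ?_
    rw [← mul_right_inj' hn, coeff_log_mul_choose_succ]
    simp only [id]
    field_simp
    ring

theorem continuous_coeff_log_mul (n : ℕ) : Continuous fun x : ℝ =>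
      (PowerSeries.coeff n (PowerSeries.log ℝ * PowerSeries.mk (Ring.choose x))) := by
  simp_rw [PowerSeries.coeff_mul, PowerSeries.coeff_mk]
  have := continuous_choose_real
  fun_prop

/-- Integrating d/dx (1+X)^x over [0,1] gives log(1+X)·∫(1+X)^x dx = (1+X) - 1 = X, the identity
that defines the Cauchy numbers; then cancel the logarithm. -/
theorem cauchyNumber_eq_integral (n : ℕ) :
    cauchyNumber n / n.factorial = ∫ x in (0 : ℝ)..1, Ring.choose x n := by
  have key : PowerSeries.log ℝ *
      (PowerSeries.mk fun n => ∫ x in (0 : ℝ)..1, Ring.choose x n) = PowerSeries.X := by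
    ext m
    have h := intervalIntegral.integral_eq_sub_of_hasDerivAt (a := 0) (b := 1)
      (fun x _ => hasDerivAt_choose_real m x)
      ((continuous_coeff_log_mul m).intervalIntegrable 0 1)
    simp_rw [PowerSeries.coeff_mul, PowerSeries.coeff_mk] at h ⊢
    rw [intervalIntegral.integral_finsetSum] at h
    · simp_rw [intervalIntegral.integral_const_mul] at h
      rw [h, PowerSeries.coeff_X]
      have h1 : Ring.choose (1 : ℝ) m = Nat.choose 1 m := by
        simpa using Ring.choose_natCast (R := ℝ) 1 m
      rw [h1]
      match m with
      | 0 => simp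
      | 1 => simp
      | m + 2 => simp [Nat.choose_eq_zero_of_lt]
    · intro i _
      exact ((continuous_choose_real _).const_mul _).intervalIntegrable 0 1
  have h0 : PowerSeries.log ℝ ≠ 0 := by
    intro h
    have := PowerSeries.coeff_one_log (A := ℝ)
    simp [h] at this
  have := mul_left_cancel₀ h0 (key.trans log_mul_cauchyNumber_egf.symm)
  have := congrArg (PowerSeries.coeff n) this
  simpa using this.symm

/-! ### Stirling numbers and the Taylor series at 0. -/

/-- The product `r (r + 1) ⋯ (r + n - 1) / n!`. -/
noncomputable def risingRatio (r : ℝ) (n : ℕ) : ℝ := ∏ k ∈ range n, ((r + k) / (k + 1))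

theorem risingRatio_succ (r : ℝ) (n : ℕ) :
    risingRatio r (n + 1) = risingRatio r n * ((r + n) / (n + 1)) :=
  prod_range_succ _ _

theorem risingRatio_nonneg {r : ℝ} (hr : 0 ≤ r) (n : ℕ) : 0 ≤ risingRatio r n :=
  prod_nonneg fun _ _ => by positivity

theorem abs_choose_real_le_risingRatio {x r : ℝ} (hx : |x| ≤ r) (n : ℕ) :
    |Ring.choose x n| ≤ risingRatio r n := by
  have hr : 0 ≤ r := (abs_nonneg x).trans hx
  induction n with
  | zero => simp [risingRatio]
  | succ n ih =>
    have h1 : |(x - n) / (n + 1)| ≤ (r + n) / (n + 1) := by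
      rw [abs_div, abs_of_pos (by positivity : (0 : ℝ) < n + 1)]
      gcongr
      calc |x - n| ≤ |x| + |(n : ℝ)| := abs_sub x n
        _ ≤ r + n := by rw [Nat.abs_cast]; gcongr
    rw [choose_real_succ, abs_mul, risingRatio_succ]
    exact mul_le_mul ih h1 (abs_nonneg _) (risingRatio_nonneg hr n)

/-- Raabe's test: the terms decay like n^(-5/4). -/
theorem summable_risingRatio_mul_centralRatio :
    Summable fun n => risingRatio (1 / 4) n * centralRatio n := by
  set u : ℕ → ℝ := fun n => risingRatio (1 / 4) n * centralRatio n with hu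
  have hu0 (n : ℕ) : 0 ≤ u n :=
    mul_nonneg (risingRatio_nonneg (by norm_num) n) (centralRatio_pos n).le
  -- The factor 16 is forced by n = 0, where equality holds.
  have hstep (n : ℕ) : u (n + 1) ≤ 16 * ((n + 1) * u (n + 1) - (n + 2) * u (n + 2)) := by
    have h : u (n + 2) =
        u (n + 1) * (((1 / 4 + (n + 1)) / (n + 2)) * ((2 * (n + 1) + 1) / (2 * (n + 2)))) := by
      simp only [hu]
      rw [show n + 2 = n + 1 + 1 from rfl, risingRatio_succ (1 / 4) (n + 1),
        centralRatio_succ (n + 1)]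
      push_cast
      rw [show (n : ℝ) + 1 + 1 = n + 2 by ring, show 2 * ((n : ℝ) + 1) + 2 = 2 * (n + 2) by ring]
      ring
    have hn : (n : ℝ) + 2 ≠ 0 := by positivity
    have e : 16 * ((n + 1) * u (n + 1) - (n + 2) * u (n + 2)) - u (n + 1) =
        u (n + 1) * (3 * n / (n + 2)) := by
      rw [h]
      field_simp
      ring
    have := mul_nonneg (hu0 (n + 1)) (by positivity : 0 ≤ 3 * (n : ℝ) / (n + 2))
    linarith
  refine (summable_nat_add_iff 1).1
    (summable_of_sum_range_le (c := 16 * u 1) (fun n => hu0 (n + 1)) fun k => ?_)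
  have : ∑ n ∈ range k, u (n + 1) ≤ 16 * (u 1 - (k + 1) * u (k + 1)) := by
    induction k with
    | zero => simp
    | succ k ih =>
      rw [sum_range_succ]
      have := hstep k
      push_cast
      rw [show (k : ℝ) + 1 + 1 = k + 2 by ring, show k + 1 + 1 = k + 2 from rfl]
      linarith
  have h2 := mul_nonneg (by positivity : (0 : ℝ) ≤ k + 1) (hu0 (k + 1))
  linarith

theorem signedStirlingFirst_eq_zero {n m : ℕ} (h : n < m) : signedStirlingFirst n m = 0 := by
  apply Polynomial.coeff_eq_zero_of_natDegree_lt
  rwa [descPochhammer_natDegree]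

theorem hasSum_signedStirlingFirst (x : ℝ) (n : ℕ) :
    HasSum (fun m => (signedStirlingFirst n m : ℝ) * x ^ m) (n.factorial * Ring.choose x n) := by
  rw [factorial_mul_choose_real, Polynomial.aeval_eq_sum_range, descPochhammer_natDegree]
  simp_rw [zsmul_eq_mul]
  refine hasSum_sum_of_ne_finset_zero fun m hm => ?_
  rw [signedStirlingFirst_eq_zero (by simpa using hm)]
  simp

theorem signedStirlingFirst_succ_zero (n : ℕ) :
    signedStirlingFirst (n + 1) 0 = -(n * signedStirlingFirst n 0) := by
  rw [signedStirlingFirst, descPochhammer_succ_right, Polynomial.mul_coeff_zero,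
    signedStirlingFirst]
  simp [mul_comm]

theorem signedStirlingFirst_succ_succ (n m : ℕ) :
    signedStirlingFirst (n + 1) (m + 1) =
      signedStirlingFirst n m - n * signedStirlingFirst n (m + 1) := by
  rw [signedStirlingFirst, descPochhammer_succ_right, mul_sub, Polynomial.coeff_sub,
    Polynomial.coeff_mul_X, signedStirlingFirst, signedStirlingFirst, mul_comm _ (n : Polynomial ℤ),
    ← Polynomial.C_eq_natCast, Polynomial.coeff_C_mul]

/-- Taking absolute values in the Stirling recurrence turns z - n into r + n, so the falling
factorial becomes a rising one. -/
theorem sum_abs_signedStirlingFirst_le {r : ℝ} (hr : 0 ≤ r) (n k : ℕ) :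
    ∑ m ∈ range k, |(signedStirlingFirst n m : ℝ)| * r ^ m ≤ n.factorial * risingRatio r n := by
  induction n generalizing k with
  | zero =>
    have h (m : ℕ) : |(signedStirlingFirst 0 m : ℝ)| * r ^ m = if m = 0 then 1 else 0 := by
      cases m <;> simp [signedStirlingFirst, Polynomial.coeff_one]
    simp_rw [h]
    rw [sum_ite_eq']
    split_ifs <;> simp [risingRatio]
  | succ n ih =>
    have e : ((n + 1).factorial : ℝ) * risingRatio r (n + 1) =
        r * (n.factorial * risingRatio r n) + n * (n.factorial * risingRatio r n) := by
      rw [risingRatio_succ, Nat.factorial_succ]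
      push_cast
      have hn : (n : ℝ) + 1 ≠ 0 := by positivity
      field_simp
    have h0 : |(signedStirlingFirst (n + 1) 0 : ℝ)| * r ^ 0 =
        n * (|(signedStirlingFirst n 0 : ℝ)| * r ^ 0) := by
      rw [signedStirlingFirst_succ_zero]
      push_cast
      rw [abs_neg, abs_mul, Nat.abs_cast, mul_assoc]
    have hs (m : ℕ) : |(signedStirlingFirst (n + 1) (m + 1) : ℝ)| * r ^ (m + 1) ≤
        r * (|(signedStirlingFirst n m : ℝ)| * r ^ m) +
          n * (|(signedStirlingFirst n (m + 1) : ℝ)| * r ^ (m + 1)) := by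
      rw [signedStirlingFirst_succ_succ]
      push_cast
      have := abs_sub (signedStirlingFirst n m : ℝ) (n * signedStirlingFirst n (m + 1))
      rw [abs_mul, Nat.abs_cast] at this
      have := mul_le_mul_of_nonneg_right this (pow_nonneg hr (m + 1))
      refine this.trans_eq ?_
      ring
    have hr0 := mul_le_mul_of_nonneg_left (ih k) hr
    have hn0 := mul_le_mul_of_nonneg_left (ih (k + 1)) (Nat.cast_nonneg (α := ℝ) n)
    calc ∑ m ∈ range k, |(signedStirlingFirst (n + 1) m : ℝ)| * r ^ m
        ≤ ∑ m ∈ range (k + 1), |(signedStirlingFirst (n + 1) m : ℝ)| * r ^ m :=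
          sum_le_sum_of_subset_of_nonneg (range_mono (Nat.le_succ k))
            fun _ _ _ => by positivity
      _ ≤ (∑ m ∈ range k, (r * (|(signedStirlingFirst n m : ℝ)| * r ^ m) +
          n * (|(signedStirlingFirst n (m + 1) : ℝ)| * r ^ (m + 1)))) +
            n * (|(signedStirlingFirst n 0 : ℝ)| * r ^ 0) := by
          rw [sum_range_succ', h0]
          gcongr
          exact hs _
      _ = r * ∑ m ∈ range k, |(signedStirlingFirst n m : ℝ)| * r ^ m +
          n * ∑ m ∈ range (k + 1), |(signedStirlingFirst n m : ℝ)| * r ^ m := by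
          rw [sum_add_distrib, ← mul_sum, ← mul_sum, sum_range_succ' _ k]
          ring
      _ ≤ _ := by
          rw [e]
          exact add_le_add hr0 hn0

/-- The terms `(-1) ^ n s(n, m) / (n! 4 ^ n) * binom (2 n) n`. -/
noncomputable def stirlingTerm (n m : ℕ) : ℝ :=
  (-1) ^ n * signedStirlingFirst n m / n.factorial * centralRatio n

theorem summable_stirlingTerm {x : ℝ} (hx : |x| ≤ 1 / 4) :
    Summable fun p : ℕ × ℕ => stirlingTerm p.1 p.2 * x ^ p.2 := by
  have hab (n m : ℕ) : ‖stirlingTerm n m * x ^ m‖ =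
      |(signedStirlingFirst n m : ℝ)| * |x| ^ m * (centralRatio n / n.factorial) := by
    rw [stirlingTerm, Real.norm_eq_abs, abs_mul, abs_mul, abs_div, abs_mul, abs_pow, abs_neg,
      abs_one, one_pow, one_mul, Nat.abs_cast, abs_of_pos (centralRatio_pos n), abs_pow]
    ring
  have hc (n : ℕ) : 0 ≤ centralRatio n / n.factorial :=
    div_nonneg (centralRatio_pos n).le (by positivity)
  have hle (n k : ℕ) : ∑ m ∈ range k, ‖stirlingTerm n m * x ^ m‖ ≤
      risingRatio (1 / 4) n * centralRatio n := by
    simp_rw [hab]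
    rw [← sum_mul]
    calc _ ≤ (n.factorial * risingRatio (1 / 4) n) * (centralRatio n / n.factorial) := by
          refine mul_le_mul_of_nonneg_right (le_trans ?_
            (sum_abs_signedStirlingFirst_le (by norm_num) n k)) (hc n)
          gcongr
      _ = _ := by
          have hf : (n.factorial : ℝ) ≠ 0 := by exact_mod_cast n.factorial_ne_zero
          field_simp
  refine Summable.of_norm ((summable_prod_of_nonneg fun p => norm_nonneg _).2 ⟨fun n => ?_, ?_⟩)
  · exact summable_of_sum_range_le (fun m => norm_nonneg _) (hle n)
  · refine summable_risingRatio_mul_centralRatio.of_nonneg_of_le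
      (fun n => tsum_nonneg fun m => norm_nonneg _) fun n => ?_
    exact Real.tsum_le_of_sum_range_le (fun m => norm_nonneg _) (hle n)

/-- A column of the double series at x = 1/4, with the nonzero factor (1/4)^m removed. -/
theorem summable_stirlingTerm_left (m : ℕ) : Summable fun n => stirlingTerm n m := by
  have h := (summable_stirlingTerm (x := 1 / 4) (by norm_num)).prod_symm.prod_factor m
  have h4 : ((1 : ℝ) / 4) ^ m ≠ 0 := by positivity
  exact (summable_mul_right_iff h4).1 h

/-- Summed by rows, the double series is the Newton series; summed by columns, it is a power series
in x. -/
theorem hasSum_taylor {x : ℝ} (hx : |x| ≤ 1 / 4) :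
    HasSum (fun m => (∑' n, stirlingTerm n m) * x ^ m) (realCentralBinom x / 4 ^ x) := by
  have hs := summable_stirlingTerm hx
  have hrow (n : ℕ) : HasSum (fun m => stirlingTerm n m * x ^ m)
      ((-1) ^ n * Ring.choose x n * centralRatio n) := by
    have h := (hasSum_signedStirlingFirst x n).mul_left ((-1) ^ n / n.factorial * centralRatio n)
    have hf : (n.factorial : ℝ) ≠ 0 := by exact_mod_cast n.factorial_ne_zero
    convert! h using 1
    · ext m
      rw [stirlingTerm]
      ring
    · field_simp
  have hN := hasSum_newton (x := x) (by linarith [(abs_le.1 hx).1])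
    (summable_risingRatio_mul_centralRatio.of_nonneg_of_le
      (fun n => mul_nonneg (abs_nonneg _) (centralRatio_pos _).le)
      fun n => mul_le_mul_of_nonneg_right (abs_choose_real_le_risingRatio hx n)
        (centralRatio_pos _).le)
  have htot := hs.hasSum
  rw [(htot.prod_fiberwise hrow).unique hN] at htot
  refine ((Equiv.prodComm ℕ ℕ).hasSum_iff.2 htot).prod_fiberwise fun m => ?_
  exact (summable_stirlingTerm_left m).hasSum.mul_right _

theorem hasFPowerSeriesOnBall_taylor :
    HasFPowerSeriesOnBall (fun x : ℝ => realCentralBinom x / 4 ^ x)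
      (FormalMultilinearSeries.ofScalars ℝ fun m => ∑' n, stirlingTerm n m) 0
      ((1 / 4 : NNReal) : ENNReal) where
  r_le := by
    refine FormalMultilinearSeries.le_radius_of_summable_norm _ ?_
    have h := (hasSum_taylor (x := 1 / 4) (by norm_num)).summable.norm
    simpa [FormalMultilinearSeries.ofScalars_norm] using h
  r_pos := by simp
  hasSum := by
    intro y hy
    have hy' : |y| ≤ 1 / 4 := by
      have := Metric.mem_eball.1 hy
      rw [edist_zero_right, enorm_lt_coe] at this
      have : ‖y‖ < (1 / 4 : ℝ) := by exact_mod_cast this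
      exact this.le
    simpa [FormalMultilinearSeries.ofScalars_apply_eq, mul_comm] using hasSum_taylor hy'

theorem iteratedDeriv_eq_tsum_stirlingTerm (m : ℕ) :
    iteratedDeriv m (fun x : ℝ => realCentralBinom x / 4 ^ x) 0 / m.factorial =
      ∑' n, stirlingTerm n m := by
  have h1 := hasFPowerSeriesOnBall_taylor.hasFPowerSeriesAt
  have h2 := h1.analyticAt.hasFPowerSeriesAt
  have h := h2.eq_formalMultilinearSeries h1
  have hc := congrArg (fun p => FormalMultilinearSeries.coeff p m) h
  simpa [FormalMultilinearSeries.coeff_ofScalars] using hc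

/-! ### Taylor approximation at 1/2 and the quadrature error. -/

/-- From u^j/j! ≤ e^u the tail is dominated by a geometric series of ratio 5/9, and 9/4 = 1/(1 -
5/9). -/
theorem abs_exp_sub_sum_le {s u : ℝ} (h : |s| ≤ 5 / 9 * u) (J : ℕ) :
    |Real.exp s - ∑ j ∈ range J, s ^ j / j.factorial| ≤ 9 / 4 * (5 / 9) ^ J * Real.exp u := by
  have hu : 0 ≤ u := by linarith [abs_nonneg s]
  have hs : HasSum (fun j : ℕ => s ^ j / j.factorial) (Real.exp s) := by
    rw [Real.exp_eq_exp_ℝ]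
    exact NormedSpace.expSeries_div_hasSum_exp s
  have ht := (hasSum_nat_add_iff' J).2 hs
  have hg := (hasSum_geometric_of_lt_one (r := (5 / 9 : ℝ)) (by norm_num) (by norm_num)).mul_left
    ((5 / 9) ^ J * Real.exp u)
  rw [← ht.tsum_eq]
  refine (tsum_of_norm_bounded (E := ℝ) hg fun n => ?_).trans_eq (by ring)
  have hf : (0 : ℝ) < (n + J).factorial := by exact_mod_cast (n + J).factorial_pos
  rw [Real.norm_eq_abs, abs_div, abs_pow, Nat.abs_cast]
  calc |s| ^ (n + J) / (n + J).factorial ≤ (5 / 9 * u) ^ (n + J) / (n + J).factorial := by gcongr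
    _ = (5 / 9) ^ (n + J) * (u ^ (n + J) / (n + J).factorial) := by rw [mul_pow, mul_div_assoc]
    _ ≤ (5 / 9) ^ (n + J) * Real.exp u := by
        gcongr
        exact Real.pow_div_factorial_le_exp u hu _
    _ = _ := by ring

theorem sqrt_mul_exp_eq {t : ℝ} (ht0 : 0 < t) :
    t ^ (1 / 2 : ℝ) * Real.exp (-(9 / 10) * Real.log t) = t ^ (-(2 / 5) : ℝ) := by
  rw [mul_comm (-(9 / 10)), ← Real.rpow_def_of_pos ht0, ← Real.rpow_add ht0]
  norm_num

/-- Write t^x = √t·exp((x - 1/2) log t) and take u = -(9/10) log t, so that 5/9 = (1/2)/(9/10). Then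
√t·e^u = t^(-2/5), which is still integrable because -2/5 > -1/2. -/
theorem abs_rpow_sub_taylor_le {t x : ℝ} (ht0 : 0 < t) (ht1 : t < 1) (h0 : 0 ≤ x) (h1 : x ≤ 1)
    (J : ℕ) :
    |t ^ x - ∑ j ∈ range J, t ^ (1 / 2 : ℝ) * (Real.log t ^ j / j.factorial) * (x - 1 / 2) ^ j| ≤
      9 / 4 * (5 / 9) ^ J * t ^ (-(2 / 5) : ℝ) := by
  have hL := Real.log_neg ht0 ht1
  have hs : |(x - 1 / 2) * Real.log t| ≤ 5 / 9 * (-(9 / 10) * Real.log t) := by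
    rw [abs_mul, abs_of_neg hL]
    have : |x - 1 / 2| ≤ 1 / 2 := abs_le.2 ⟨by linarith, by linarith⟩
    nlinarith
  have h := abs_exp_sub_sum_le hs J
  have hp : 0 < t ^ (1 / 2 : ℝ) := Real.rpow_pos_of_pos ht0 _
  have e : t ^ x - ∑ j ∈ range J, t ^ (1 / 2 : ℝ) * (Real.log t ^ j / j.factorial) *
      (x - 1 / 2) ^ j = t ^ (1 / 2 : ℝ) * (Real.exp ((x - 1 / 2) * Real.log t) -
        ∑ j ∈ range J, ((x - 1 / 2) * Real.log t) ^ j / j.factorial) := by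
    rw [mul_sub, mul_sum, mul_comm (x - 1 / 2), ← Real.rpow_def_of_pos ht0, ← Real.rpow_add ht0]
    congr 1
    · ring_nf
    · refine sum_congr rfl fun j _ => ?_
      rw [mul_pow]
      ring
  rw [e, abs_mul, abs_of_pos hp, ← sqrt_mul_exp_eq ht0]
  calc _ ≤ t ^ (1 / 2 : ℝ) * _ := mul_le_mul_of_nonneg_left h hp.le
    _ = _ := by ring

theorem abs_sqrt_mul_log_pow_le {t : ℝ} (ht0 : 0 < t) (ht1 : t < 1) (j : ℕ) :
    |t ^ (1 / 2 : ℝ) * (Real.log t ^ j / j.factorial)| ≤ (10 / 9) ^ j * t ^ (-(2 / 5) : ℝ) := by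
  have hL := Real.log_neg ht0 ht1
  have hp : 0 < t ^ (1 / 2 : ℝ) := Real.rpow_pos_of_pos ht0 _
  have h := Real.pow_div_factorial_le_exp (-(9 / 10) * Real.log t) (by linarith) j
  rw [abs_mul, abs_of_pos hp, abs_div, Nat.abs_cast, abs_pow, abs_of_neg hL, ← sqrt_mul_exp_eq ht0]
  have e : (-Real.log t) ^ j / j.factorial =
      (10 / 9) ^ j * ((-(9 / 10) * Real.log t) ^ j / j.factorial) := by
    rw [← mul_div_assoc, ← mul_pow]
    ring_nf
  rw [e]
  calc _ ≤ t ^ (1 / 2 : ℝ) * ((10 / 9) ^ j * Real.exp (-(9 / 10) * Real.log t)) := by gcongr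
    _ = _ := by ring

theorem realCentralBinom_div_add_one {x : ℝ} (hx : -(1 / 2) < x) :
    realCentralBinom x / 4 ^ x =
      realCentralBinom (x + 1) / 4 ^ (x + 1) * ((x + 1) / (x + 1 / 2)) := by
  have h1 : Real.Gamma (x + 1) ≠ 0 := (Real.Gamma_pos_of_pos (by linarith)).ne'
  have h2 : x + 1 / 2 ≠ 0 := by linarith
  have h3 : x + 1 ≠ 0 := by linarith
  have hp := Real.pi_pos.ne'
  rw [realCentralBinom_div_eq_Gamma hx, realCentralBinom_div_eq_Gamma (by linarith : _ < x + 1),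
    beta, beta, show x + 1 + 1 / 2 = (x + 1 / 2) + 1 by ring,
    show x + 1 / 2 + 1 + 1 / 2 = (x + 1) + 1 by ring, show x + 1 / 2 + 1 / 2 = x + 1 by ring,
    Real.Gamma_add_one h2, Real.Gamma_add_one h3]
  generalize x + 1 / 2 = y at *
  field_simp

theorem realCentralBinom_div_le_one {x : ℝ} (hx : 0 ≤ x) : realCentralBinom x / 4 ^ x ≤ 1 := by
  rw [← integral_rpow_arcsineMeasure (by linarith)]
  calc ∫ t, t ^ x ∂arcsineMeasure ≤ ∫ t, (1 : ℝ) ∂arcsineMeasure := by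
        refine integral_mono_ae (integrable_rpow_arcsineMeasure (by linarith))
          (integrable_const _) ?_
        filter_upwards [ae_arcsineMeasure] with t ht
        exact Real.rpow_le_one ht.1.le ht.2.le hx
    _ = 1 := by simp

/-- The functional equation gives f(-2/5) = 6 f(3/5), and f ≤ 1 on [0,∞). -/
theorem integral_rpow_neg_le : ∫ t, t ^ (-(2 / 5) : ℝ) ∂arcsineMeasure ≤ 6 := by
  rw [integral_rpow_arcsineMeasure (by norm_num), realCentralBinom_div_add_one (by norm_num)]
  have h := realCentralBinom_div_le_one (x := -(2 / 5) + 1) (by norm_num)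
  norm_num at h ⊢
  linarith

/-- Approximation on `[0, 1]` by polynomials centred at `1 / 2` with geometrically bounded
coefficients. -/
theorem exists_taylor_coeff : ∃ φ : ℕ → ℝ, (∀ j, |φ j| ≤ 6 * (10 / 9) ^ j) ∧
    ∀ J x, 0 ≤ x → x ≤ 1 →
      |realCentralBinom x / 4 ^ x - ∑ j ∈ range J, φ j * (x - 1 / 2) ^ j| ≤
        27 / 2 * (5 / 9) ^ J := by
  have hint : Integrable (fun t : ℝ => t ^ (-(2 / 5) : ℝ)) arcsineMeasure :=
    integrable_rpow_arcsineMeasure (by norm_num)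
  have hφ (j : ℕ) : Integrable
      (fun t : ℝ => t ^ (1 / 2 : ℝ) * (Real.log t ^ j / j.factorial)) arcsineMeasure := by
    refine (hint.const_mul ((10 / 9) ^ j)).mono' ?_ ?_
    · exact Measurable.aestronglyMeasurable (by fun_prop)
    · filter_upwards [ae_arcsineMeasure] with t ht
      exact abs_sqrt_mul_log_pow_le ht.1 ht.2 j
  -- The coefficients come from expanding t^x in powers of x - 1/2 under the integral.
  refine ⟨fun j => ∫ t, t ^ (1 / 2 : ℝ) * (Real.log t ^ j / j.factorial) ∂arcsineMeasure,
    fun j => ?_, fun J x h0 h1 => ?_⟩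
  · have := norm_integral_le_of_norm_le
      (f := fun t => t ^ (1 / 2 : ℝ) * (Real.log t ^ j / j.factorial))
      (hint.const_mul ((10 / 9) ^ j)) (by
      filter_upwards [ae_arcsineMeasure] with t ht
      exact abs_sqrt_mul_log_pow_le ht.1 ht.2 j)
    rw [Real.norm_eq_abs, integral_const_mul] at this
    refine this.trans ?_
    rw [mul_comm]
    gcongr
    exact integral_rpow_neg_le
  · have hx : -(1 / 2) < x := by linarith
    have e : realCentralBinom x / 4 ^ x - ∑ j ∈ range J,
        (∫ t, t ^ (1 / 2 : ℝ) * (Real.log t ^ j / j.factorial) ∂arcsineMeasure) *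
          (x - 1 / 2) ^ j = ∫ t, (t ^ x - ∑ j ∈ range J,
            t ^ (1 / 2 : ℝ) * (Real.log t ^ j / j.factorial) * (x - 1 / 2) ^ j)
              ∂arcsineMeasure := by
      rw [integral_sub (integrable_rpow_arcsineMeasure hx)
        (integrable_finsetSum _ fun j _ => (hφ j).mul_const _),
        integral_finsetSum _ fun j _ => (hφ j).mul_const _, integral_rpow_arcsineMeasure hx]
      simp_rw [integral_mul_const]
    rw [e]
    have := norm_integral_le_of_norm_le
      (f := fun t => t ^ x - ∑ j ∈ range J,
        t ^ (1 / 2 : ℝ) * (Real.log t ^ j / j.factorial) * (x - 1 / 2) ^ j)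
      (hint.const_mul (9 / 4 * (5 / 9) ^ J)) (by
      filter_upwards [ae_arcsineMeasure] with t ht
      exact abs_rpow_sub_taylor_le ht.1 ht.2 h0 h1 J)
    rw [Real.norm_eq_abs, integral_const_mul] at this
    refine this.trans ?_
    have h6 := integral_rpow_neg_le
    calc _ ≤ 9 / 4 * (5 / 9) ^ J * (6 : ℝ) := by gcongr
      _ = _ := by ring

theorem intervalIntegrable_realCentralBinom_div :
    IntervalIntegrable (fun x : ℝ => realCentralBinom x / (4 : ℝ) ^ x) volume 0 1 := by
  refine ContinuousOn.intervalIntegrable fun x hx => ?_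
  rw [Set.uIcc_of_le zero_le_one] at hx
  have h1 (s : ℝ) (hs : 0 < s) : ContinuousAt Real.Gamma s :=
    (Real.differentiableAt_Gamma fun m => by
      have : (0 : ℝ) ≤ m := m.cast_nonneg
      linarith).continuousAt
  refine ContinuousAt.continuousWithinAt ?_
  unfold realCentralBinom
  have hg := (Real.Gamma_pos_of_pos (by linarith [hx.1] : 0 < x + 1)).ne'
  refine ((ContinuousAt.comp (f := fun x : ℝ => 2 * x + 1) (h1 _ (by linarith [hx.1]))
    (by fun_prop)).div ((ContinuousAt.comp (f := fun x : ℝ => x + 1) (h1 _ (by linarith [hx.1]))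
    (by fun_prop)).pow 2) (pow_ne_zero 2 hg)).div ?_ ?_
  · exact Real.continuousAt_const_rpow (by norm_num)
  · exact (Real.rpow_pos_of_pos (by norm_num) x).ne'

theorem integral_sub_half_pow (j : ℕ) :
    ∫ x in (0 : ℝ)..1, (x - 1 / 2) ^ j = ((1 / 2) ^ (j + 1) - (-1 / 2) ^ (j + 1)) / (j + 1) := by
  rw [intervalIntegral.integral_comp_sub_right (fun x : ℝ => x ^ j), integral_pow]
  norm_num

/-- Error bound for a quadrature rule on `[0, 1]` whose moments up to order `J` are nearly
exact. -/
theorem abs_integral_sub_quadrature_le {ι : Type*} [Fintype ι] (x w : ι → ℝ)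
    (hx : ∀ i, 0 ≤ x i ∧ x i ≤ 1) (hw : ∀ i, 0 ≤ w i) (J : ℕ) (κ : ℝ)
    (hmom : ∀ j < J, |((1 / 2) ^ (j + 1) - (-1 / 2) ^ (j + 1)) / (j + 1) -
      ∑ i, w i * (x i - 1 / 2) ^ j| * (10 / 9) ^ j ≤ κ) :
    |(∫ x in (0 : ℝ)..1, realCentralBinom x / (4 : ℝ) ^ x) -
      ∑ i, w i * (realCentralBinom (x i) / 4 ^ x i)| ≤
        6 * J * κ + (1 + ∑ i, w i) * (27 / 2 * (5 / 9) ^ J) := by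
  obtain ⟨φ, hφ, happ⟩ := exists_taylor_coeff
  set f : ℝ → ℝ := fun x => realCentralBinom x / 4 ^ x with hf
  set p : ℝ → ℝ := fun x => ∑ j ∈ range J, φ j * (x - 1 / 2) ^ j with hp
  set ε : ℝ := 27 / 2 * (5 / 9) ^ J with hε
  have hpc : Continuous p := by fun_prop
  -- The error splits into the integral of f - p, the rule applied to f - p, and the rule's error on
  -- p; the last is bounded moment by moment, the weight (10/9)^j in `hmom` matching the growth of
  -- φ.
  have h1 : |∫ x in (0 : ℝ)..1, (f x - p x)| ≤ ε := by
    have := intervalIntegral.norm_integral_le_of_norm_le_const (a := (0 : ℝ)) (b := 1)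
      (f := fun x => f x - p x) (C := ε) fun y hy => by
        rw [Set.uIoc_of_le zero_le_one] at hy
        exact happ J y hy.1.le hy.2
    simpa using this
  rw [intervalIntegral.integral_sub intervalIntegrable_realCentralBinom_div
    (hpc.intervalIntegrable 0 1)] at h1
  have h2 : |∑ i, w i * (f (x i) - p (x i))| ≤ (∑ i, w i) * ε := by
    rw [sum_mul]
    refine (abs_sum_le_sum_abs _ _).trans (sum_le_sum fun i _ => ?_)
    rw [abs_mul, abs_of_nonneg (hw i)]
    exact mul_le_mul_of_nonneg_left (happ J _ (hx i).1 (hx i).2) (hw i)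
  have h3 : |(∫ x in (0 : ℝ)..1, p x) - ∑ i, w i * p (x i)| ≤ 6 * J * κ := by
    have e : (∫ x in (0 : ℝ)..1, p x) - ∑ i, w i * p (x i) =
        ∑ j ∈ range J, φ j * (((1 / 2) ^ (j + 1) - (-1 / 2) ^ (j + 1)) / (j + 1) -
          ∑ i, w i * (x i - 1 / 2) ^ j) := by
      simp only [hp]
      rw [intervalIntegral.integral_finsetSum fun j _ =>
        (Continuous.intervalIntegrable (by fun_prop) 0 1)]
      simp_rw [intervalIntegral.integral_const_mul, integral_sub_half_pow, mul_sub, mul_sum]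
      rw [sum_sub_distrib, sum_comm (s := univ)]
      congr 1
      refine sum_congr rfl fun j _ => sum_congr rfl fun i _ => by ring
    rw [e]
    calc _ ≤ ∑ j ∈ range J, 6 * κ := by
          refine (abs_sum_le_sum_abs _ _).trans (sum_le_sum fun j hj => ?_)
          rw [abs_mul]
          have := hmom j (mem_range.1 hj)
          have := mul_le_mul_of_nonneg_right (hφ j) (abs_nonneg
            (((1 / 2) ^ (j + 1) - (-1 / 2) ^ (j + 1)) / ((j : ℝ) + 1) -
              ∑ i, w i * (x i - 1 / 2) ^ j))
          linarith
      _ = _ := by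
          rw [sum_const, card_range, nsmul_eq_mul]
          ring
  simp_rw [mul_sub, sum_sub_distrib] at h2
  rw [abs_le] at *
  constructor <;> linarith

/-! ### Rational approximation of f on [0,1]. -/

/-- The terms of the Newton series of `x ↦ binom (2 (N + x)) (N + x) / 4 ^ (N + x)`, divided by the
value at `x = 0`. -/
noncomputable def newtonTerm (N : ℕ) (x : ℝ) (n : ℕ) : ℝ :=
  (-1) ^ n * Ring.choose x n * centralRatio n / (N + n).choose n

/-- Horner evaluation of a section of the sum of `newtonTerm N x`, divided by its first term. -/
noncomputable def newtonHorner (N : ℕ) (x : ℝ) : ℕ → ℕ → ℝ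
  | 0, _ => 1
  | m + 1, k => 1 + (k - x) * (2 * k + 1) / ((2 * k + 2) * (N + k + 1)) *
      newtonHorner N x m (k + 1)

theorem newtonTerm_succ (N : ℕ) (x : ℝ) (n : ℕ) :
    newtonTerm N x (n + 1) =
      newtonTerm N x n * ((n - x) * (2 * n + 1) / ((2 * n + 2) * (N + n + 1))) := by
  have h : ((N : ℝ) + n + 1) * (N + n).choose n = (N + (n + 1)).choose (n + 1) * (n + 1) := by
    exact_mod_cast Nat.add_one_mul_choose_eq (N + n) n
  have h1 : (n : ℝ) + 1 ≠ 0 := by positivity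
  have h2 : (N : ℝ) + n + 1 ≠ 0 := by positivity
  have h3 : ((N + n).choose n : ℝ) ≠ 0 := by
    exact_mod_cast (Nat.choose_pos (Nat.le_add_left n N)).ne'
  rw [newtonTerm, newtonTerm, choose_real_succ, centralRatio_succ,
    eq_div_of_mul_eq h1 h.symm, pow_succ]
  have h4 : 2 * (n : ℝ) + 2 ≠ 0 := by positivity
  field_simp
  ring

theorem sum_newtonTerm (N : ℕ) (x : ℝ) (m k : ℕ) :
    ∑ n ∈ range (m + 1), newtonTerm N x (k + n) = newtonTerm N x k * newtonHorner N x m k := by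
  induction m generalizing k with
  | zero => simp [newtonHorner]
  | succ m ih =>
    rw [sum_range_succ']
    have := ih (k + 1)
    rw [sum_congr rfl fun n _ => by rw [show k + (n + 1) = k + 1 + n by ring], this, newtonTerm_succ, newtonHorner, add_zero]
    ring

/-- Weighting the binomial remainder by t^N suppresses the region near t = 0, where it is largest;
the large binomial coefficient in the bound comes from the moment of t^N (1 - t)^(m+1). -/
theorem abs_shift_sub_newton_le {x : ℝ} (h0 : 0 ≤ x) (h1 : x ≤ 1) (N m : ℕ) :
    |realCentralBinom (x + N) / 4 ^ (x + N) - centralRatio N * newtonHorner N x m 0| ≤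
      centralRatio N * centralRatio (m + 1) / (N + (m + 1)).choose (m + 1) := by
  have hx : -(1 / 2) < x + N := by linarith [(Nat.cast_nonneg N : (0 : ℝ) ≤ N)]
  have hT (n : ℕ) (t : ℝ) : t ^ N * (Ring.choose x n * (t - 1) ^ n) =
      (-1) ^ n * Ring.choose x n * (t ^ N * (1 - t) ^ n) := by
    rw [show t - 1 = -1 * (1 - t) by ring, mul_pow]
    ring
  have hI (n : ℕ) : Integrable (fun t => t ^ N * (Ring.choose x n * (t - 1) ^ n))
      arcsineMeasure := by
    simp_rw [hT]
    exact (integrable_pow_mul_pow N n).const_mul _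
  have e : realCentralBinom (x + N) / 4 ^ (x + N) - centralRatio N * newtonHorner N x m 0 =
      ∫ t, (t ^ (x + N) - ∑ n ∈ range (m + 1), t ^ N * (Ring.choose x n * (t - 1) ^ n))
        ∂arcsineMeasure := by
    rw [integral_sub (integrable_rpow_arcsineMeasure hx) (integrable_finsetSum _ fun n _ => hI n),
      integral_finsetSum _ fun n _ => hI n, integral_rpow_arcsineMeasure hx]
    simp_rw [hT, integral_const_mul, integral_pow_mul_pow]
    have := sum_newtonTerm N x m 0
    have h00 : newtonTerm N x 0 = 1 := by simp [newtonTerm, centralRatio]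
    rw [h00, one_mul] at this
    rw [← this, mul_sum]
    congr 1
    refine sum_congr rfl fun n _ => ?_
    rw [zero_add, newtonTerm]
    ring
  rw [e, ← integral_pow_mul_pow]
  refine norm_integral_le_of_norm_le (f := fun t => t ^ (x + N) - ∑ n ∈ range (m + 1),
    t ^ N * (Ring.choose x n * (t - 1) ^ n)) (integrable_pow_mul_pow N (m + 1)) ?_
  filter_upwards [ae_arcsineMeasure] with t ht
  have hN : 0 ≤ t ^ N := pow_nonneg ht.1.le N
  rw [Real.norm_eq_abs, ← mul_sum, Real.rpow_add ht.1, Real.rpow_natCast, mul_comm (t ^ x),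
    ← mul_sub, abs_mul, abs_of_nonneg hN]
  exact mul_le_mul_of_nonneg_left (abs_rpow_sub_sum_choose_le h0 h1 ht.1 ht.2 m) hN

theorem realCentralBinom_div_eq_prod {x : ℝ} (h0 : 0 ≤ x) (N : ℕ) :
    realCentralBinom x / 4 ^ x = realCentralBinom (x + N) / 4 ^ (x + N) *
      ∏ k ∈ range N, (x + k + 1) / (x + k + 1 / 2) := by
  induction N with
  | zero => simp
  | succ N ih =>
    rw [ih, realCentralBinom_div_add_one (by linarith [(Nat.cast_nonneg N : (0 : ℝ) ≤ N)]),
      prod_range_succ]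
    push_cast
    rw [add_assoc x]
    ring

theorem centralRatio_eq_prod (N : ℕ) :
    centralRatio N = ∏ k ∈ range N, (2 * (k : ℝ) + 1) / (2 * k + 2) := by
  induction N with
  | zero => simp [centralRatio]
  | succ N ih => rw [centralRatio_succ, prod_range_succ, ih]

/-- A rational function of `x` approximating `binom (2 x) x / 4 ^ x` on `[0, 1]`. -/
noncomputable def newtonApprox (N m : ℕ) (x : ℝ) : ℝ :=
  (∏ k ∈ range N, (2 * (k : ℝ) + 1) / (2 * k + 2) * ((x + k + 1) / (x + k + 1 / 2))) *
    newtonHorner N x m 0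

theorem abs_sub_newtonApprox_le {x : ℝ} (h0 : 0 ≤ x) (h1 : x ≤ 1) (N m : ℕ) :
    |realCentralBinom x / 4 ^ x - newtonApprox N m x| ≤
      centralRatio (m + 1) / (N + (m + 1)).choose (m + 1) := by
  have h := abs_shift_sub_newton_le h0 h1 N m
  set P := ∏ k ∈ range N, (x + k + 1) / (x + k + 1 / 2) with hP
  have hP0 : 0 ≤ P := prod_nonneg fun k _ => by positivity
  -- Returning from x + N to x does not amplify the error: each paired factor is at most 1, with
  -- equality at x = 0.
  have hP1 : centralRatio N * P ≤ 1 := by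
    rw [centralRatio_eq_prod, hP, ← prod_mul_distrib]
    refine prod_le_one (fun k _ => by positivity) fun k _ => ?_
    rw [div_mul_div_comm, div_le_one (by positivity)]
    nlinarith [(Nat.cast_nonneg k : (0 : ℝ) ≤ k)]
  have e : realCentralBinom x / 4 ^ x - newtonApprox N m x =
      (realCentralBinom (x + N) / 4 ^ (x + N) - centralRatio N * newtonHorner N x m 0) * P := by
    rw [realCentralBinom_div_eq_prod h0 N, newtonApprox, prod_mul_distrib, ← centralRatio_eq_prod]
    ring
  rw [e, abs_mul, abs_of_nonneg hP0]
  calc _ ≤ centralRatio N * centralRatio (m + 1) / (N + (m + 1)).choose (m + 1) * P := by gcongr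
    _ = centralRatio N * P * (centralRatio (m + 1) / (N + (m + 1)).choose (m + 1)) := by ring
    _ ≤ 1 * (centralRatio (m + 1) / (N + (m + 1)).choose (m + 1)) :=
        mul_le_mul_of_nonneg_right hP1 (div_nonneg (centralRatio_pos _).le (by positivity))
    _ = _ := one_mul _

theorem choose_two_mul_div (n : ℕ) : ((2 * n).choose n : ℝ) = centralRatio n * 4 ^ n := by
  rw [centralRatio, Nat.centralBinom, div_mul_cancel₀]
  positivity

/-! ### Numerical evaluation by the Gauss rule. -/

/-- Nodes of a rational approximation of the 13-point Gauss rule on `[0, 1]`. -/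
noncomputable def quadNode : Fin 13 → ℝ := fun i => ![
  790847264071, 4120080038851, 9921095463335, 17882533027983, 27575362448178,
  38477084202243, 50000000000000, 61522915797757, 72424637551822, 82117466972017,
  90078904536665, 95879919961149, 99209152735929] i / 10 ^ 14

/-- Weights of a rational approximation of the 13-point Gauss rule on `[0, 1]`. -/
noncomputable def quadWeight : Fin 13 → ℝ := fun i => ![
  2024200238266, 4606074991886, 6943675510989, 8907299038097, 10390802376844,
  11314159013145, 11627577661546, 11314159013145, 10390802376844, 8907299038097,
  6943675510989, 4606074991886, 2024200238266] i / 10 ^ 14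

/-- Approximate values of `binom (2 x) x / 4 ^ x` at the nodes `quadNode`. -/
noncomputable def quadValue : Fin 13 → ℝ := fun i => ![
  989197011090568, 946975490564627, 883930622646364, 813791510691497, 746406901703396,
  686802602278118, 636619772367582, 595738982672402, 563347446682666, 538490712045409,
  520313920210449, 508149057347313, 501534398720476] i / 10 ^ 15

theorem quadNode_mem (i : Fin 13) : 0 ≤ quadNode i ∧ quadNode i ≤ 1 := by
  fin_cases i <;> norm_num [quadNode]

theorem quadWeight_nonneg (i : Fin 13) : 0 ≤ quadWeight i := by
  fin_cases i <;> norm_num [quadWeight]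

theorem sum_quadWeight : ∑ i, quadWeight i = 1 := by
  norm_num [quadWeight, Fin.sum_univ_succ]

set_option maxHeartbeats 1000000 in
-- The exact Gauss rule integrates degrees up to 25 exactly, leaving only rounding of the nodes and
-- weights there; higher moments have a genuine error. Order 56 makes the Taylor remainder
-- 27·(5/9)^56 about 1.4e-13.
theorem abs_quadMoment_le (j : ℕ) (hj : j < 56) :
    |((1 / 2) ^ (j + 1) - (-1 / 2) ^ (j + 1)) / (j + 1) -
      ∑ i, quadWeight i * (quadNode i - 1 / 2) ^ j| * (10 / 9) ^ j ≤ 13 / 10 ^ 15 := by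
  rw [← le_div_iff₀ (by positivity), abs_le]
  norm_num [quadWeight, quadNode, Fin.sum_univ_succ]
  interval_cases j <;> norm_num

theorem abs_newtonApprox_quadNode_sub_le (i : Fin 13) :
    |newtonApprox 25 17 (quadNode i) - quadValue i| ≤ 1 / 10 ^ 15 := by
  rw [abs_le]
  fin_cases i <;>
    norm_num [newtonApprox, newtonHorner, prod_range_succ, quadNode, quadValue]

theorem abs_integral_sub_le :
    |(∫ x in (0 : ℝ)..1, realCentralBinom x / (4 : ℝ) ^ x) - 6703837612 / 10 ^ 10| ≤
      5 / 10 ^ 11 := by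
  have h1 := abs_integral_sub_quadrature_le quadNode quadWeight quadNode_mem quadWeight_nonneg
    56 (13 / 10 ^ 15) abs_quadMoment_le
  have hc : centralRatio (17 + 1) / (25 + (17 + 1)).choose (17 + 1) ≤ 3 / 10 ^ 13 := by
    rw [centralRatio_eq_prod]
    norm_num [prod_range_succ, Nat.choose_eq_descFactorial_div_factorial, Nat.descFactorial,
      Nat.factorial]
  have hv (i : Fin 13) : |realCentralBinom (quadNode i) / 4 ^ quadNode i - quadValue i| ≤
      4 / 10 ^ 13 := by
    have ha := abs_sub_newtonApprox_le (quadNode_mem i).1 (quadNode_mem i).2 25 17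
    have hb := abs_newtonApprox_quadNode_sub_le i
    refine (abs_sub_le _ (newtonApprox 25 17 (quadNode i)) _).trans ?_
    linarith
  have h2 : |∑ i, quadWeight i * (realCentralBinom (quadNode i) / 4 ^ quadNode i) -
      ∑ i, quadWeight i * quadValue i| ≤ 4 / 10 ^ 13 := by
    rw [← sum_sub_distrib]
    calc _ ≤ ∑ i, quadWeight i * (4 / 10 ^ 13) := by
          refine (abs_sum_le_sum_abs _ _).trans (sum_le_sum fun i _ => ?_)
          rw [← mul_sub, abs_mul, abs_of_nonneg (quadWeight_nonneg i)]
          exact mul_le_mul_of_nonneg_left (hv i) (quadWeight_nonneg i)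
      _ = _ := by rw [← sum_mul, sum_quadWeight, one_mul]
  -- This value lies 4.114e-11 above the stated decimal, leaving about 8.8e-12 for all errors; the
  -- quadrature bound uses about 4.5e-12 and the rest about 5e-13.
  have h3 : |∑ i, quadWeight i * quadValue i - 67038376124114 / 10 ^ 14| ≤ 1 / 10 ^ 13 := by
    rw [abs_le]
    norm_num [quadWeight, quadValue, Fin.sum_univ_succ]
  rw [sum_quadWeight] at h1
  norm_num at h1 h2 h3 ⊢
  rw [abs_le] at *
  constructor <;> linarith [h1.1, h1.2, h2.1, h2.2, h3.1, h3.2]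

theorem mainTheorem3 :
    (IntervalIntegrable (fun x : ℝ => realCentralBinom x / (4 : ℝ) ^ x)
        MeasureTheory.volume 0 1 ∧
      HasSum
        (fun n : ℕ => (-1 : ℝ) ^ n * cauchyNumber n / ((n.factorial : ℝ) * (4 : ℝ) ^ n) *
          ((2 * n).choose n : ℝ))
        (∫ x in (0 : ℝ)..1, realCentralBinom x / (4 : ℝ) ^ x) ∧
      |(∫ x in (0 : ℝ)..1, realCentralBinom x / (4 : ℝ) ^ x) - 6703837612 / 10 ^ 10|
        ≤ 5 / 10 ^ 11) ∧
    (AnalyticAt ℝ (fun x : ℝ => realCentralBinom x / (4 : ℝ) ^ x) 0 ∧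
      ∀ m : ℕ, 1 ≤ m →
        HasSum
          (fun k : ℕ => (-1 : ℝ) ^ (k + 1) * (signedStirlingFirst (k + 1) m : ℝ) /
            (((k + 1).factorial : ℝ) * (4 : ℝ) ^ (k + 1)) * ((2 * (k + 1)).choose (k + 1) : ℝ))
          (iteratedDeriv m (fun x : ℝ => realCentralBinom x / (4 : ℝ) ^ x) 0 /
            (m.factorial : ℝ))) := by
  refine ⟨⟨intervalIntegrable_realCentralBinom_div, ?_, abs_integral_sub_le⟩,
    hasFPowerSeriesOnBall_taylor.analyticAt, fun m hm => ?_⟩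
  · convert! hasSum_integral_newton using 2 with n
    rw [← cauchyNumber_eq_integral, choose_two_mul_div]
    field_simp
  · have h := (summable_stirlingTerm_left m).hasSum
    rw [← iteratedDeriv_eq_tsum_stirlingTerm] at h
    -- As m ≥ 1, the term n = 0 vanishes and the sum may start at n = 1.
    have h0 : stirlingTerm 0 m = 0 := by
      rw [stirlingTerm, signedStirlingFirst_eq_zero (by omega)]
      simp
    have h' := (hasSum_nat_add_iff' 1).2 h
    rw [sum_range_one, h0, sub_zero] at h'
    convert! h' using 2 with k
    rw [stirlingTerm, choose_two_mul_div]
    field_simp
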